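/- Let $L$ be a completely regular frame, that is, a complete lattice satisfying $a\wedge\bigvee S=\bigvee\{a\wedge s\mid s\in S\}$ for all $a\in L$, $S\subseteq L$, in which every element $a$ is the join of the elements completely below it. (Here $x$ is \emph{rather below} $y$, written $x\prec y$, if there is $t\in L$ with $x\wedge t=0$ and $t\vee y=1$; and $x$ is \emph{completely below} $y$ if there are $c_q\in L$, $q\in\mathbb{Q}\cap[0,1]$, with $c_0=x$, $c_1=y$ and $c_r\prec c_s$ whenever $r<s$.) Let $\mathcal{R}L$ be the commutative ring of real-valued continuous functions on $L$, i.e. of frame homomorphisms $\varphi$ from the frame of reals $\mathcal{L}(\mathbb{R})$ to $L$, and for $\varphi\in\mathcal{R}L$ put $$\operatorname{coz}\varphi=\bigvee\{\varphi(p,0)\vee\varphi(0,q)\mid p,q\in\mathbb{Q}\}.$$ Elements of $L$ of the form $\operatorname{coz}\varphi$ are called cozero elements. An ideal $I$ of $\mathcal{R}L$ is a \emph{$z$-ideal} if $\alpha\in\mathcal{R}L$, $\varphi\in I$ and $\operatorname{coz}\alpha=\operatorname{coz}\varphi$ imply $\alpha\in I$. The frame $L$ is a \emph{$P_F$-frame}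 if, whenever $a,b$ are cozero elements of $L$ with $a\wedge b=0$, at least one of $a,b$ is complemented in $L$. Then the following statements are equivalent. \begin{enumerate} \item[(1)] Of any two ideals of $\mathcal{R}L$ whose sum is a proper $z$-ideal, at least one is a $z$-ideal. \item[(2)] $L$ is a $P_F$-frame. \item[(3)] Of any two ideals of $\mathcal{R}L$ whose intersection is a $z$-ideal, at least one is a $z$-ideal. \end{enumerate} -/

import Mathlib

open TopologicalSpace

namespace PointFree

universe u

/-! ### Completely regular frames -/

section Frames

variable {L : Type u} [Order.Frame L]

/-- `a` is rather below `b`: some `t` satisfies `a ∧ t = 0` and `t ∨ b = 1`. -/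
def RatherBelow (a b : L) : Prop :=
  ∃ t : L, a ⊓ t = ⊥ ∧ t ⊔ b = ⊤

/-- `a` is completely below `b`: there is a family `c`, indexed by the rationals of `[0, 1]`,
from `a` to `b` with `c r` rather below `c s` whenever `r < s`. -/
def CompletelyBelow (a b : L) : Prop :=
  ∃ c : Set.Icc (0 : ℚ) 1 → L, c 0 = a ∧ c 1 = b ∧ ∀ r s, r < s → RatherBelow (c r) (c s)

variable (L) in
/-- Complete regularity: every element is the join of the elements completely below it. -/
def IsCompletelyRegular : Prop :=
  ∀ a : L, a = sSup {x : L | CompletelyBelow x a}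

end Frames

/-! ### The frame of reals and real-valued continuous functions on a frame -/

/-- The open interval `(a, b)` as an open set of reals. -/
def ioo (a b : ℝ) : Opens ℝ := ⟨Set.Ioo a b, isOpen_Ioo⟩

/-- The underlying set of `ℛL`: frame homomorphisms from the frame of reals to `L`.
The frame of reals is realised as the frame of open sets of `ℝ`; the theorems
`realRelations_ioo` and `existsUnique_of_relations` below show that this frame, with the
generators `(p, q)` interpreted as rational open intervals, has the universal property of the usual
presentation of the frame of reals by generators and relations. -/
abbrev RealFun (L : Type u) [Order.Frame L] : Type u := FrameHom (Opens ℝ) L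

section Presentation

variable {L : Type u} [Order.Frame L]

/-- The defining relations of the frame of reals, for an interpretation `ρ` in `L` of the
generators `(p, q)` with `p q : ℚ`. -/
structure RealRelations (ρ : ℚ → ℚ → L) : Prop where
  inf_eq : ∀ p q r s, ρ p q ⊓ ρ r s = ρ (max p r) (min q s)
  sup_eq : ∀ p q r s, p ≤ r → r < q → q ≤ s → ρ p q ⊔ ρ r s = ρ p s
  eq_sSup : ∀ p q, ρ p q = sSup {x | ∃ r s, p < r ∧ r < s ∧ s < q ∧ x = ρ r s}
  top_eq : (⊤ : L) = ⨆ (p : ℚ) (q : ℚ), ρ p q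

theorem RealRelations.eq_bot {ρ : ℚ → ℚ → L} (h : RealRelations ρ) {p q : ℚ} (hpq : q ≤ p) :
    ρ p q = ⊥ := by
  rw [h.eq_sSup, sSup_eq_bot]
  rintro x ⟨r, s, h1, h2, h3, -⟩
  linarith

theorem RealRelations.mono {ρ : ℚ → ℚ → L} (h : RealRelations ρ) {p q r s : ℚ}
    (hsub : ioo r s ≤ ioo p q) : ρ r s ≤ ρ p q := by
  rcases le_or_gt s r with hrs | hrs
  · rw [h.eq_bot hrs]; exact bot_le
  · have h1 : Set.Ioo (r : ℝ) s ⊆ Set.Ioo (p : ℝ) q := hsub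
    rw [Set.Ioo_subset_Ioo_iff (by exact_mod_cast hrs)] at h1
    have h2 : p ≤ r := by exact_mod_cast h1.1
    have h3 : s ≤ q := by exact_mod_cast h1.2
    rw [← inf_eq_right, h.inf_eq, max_eq_right h2, min_eq_right h3]

theorem RealRelations.le_of_cover {ρ : ℚ → ℚ → L} (h : RealRelations ρ) (𝒰 : Set (Opens ℝ))
    (B : L) (hB : ∀ U ∈ 𝒰, ∀ p q : ℚ, ioo p q ≤ U → ρ p q ≤ B) (p q : ℚ)
    (hpq : ioo p q ≤ sSup 𝒰) : ρ p q ≤ B := by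
  rw [h.eq_sSup]
  refine sSup_le ?_
  rintro x ⟨r, s, hpr, hrs, hsq, rfl⟩
  obtain ⟨δ, hδ, hcov⟩ := lebesgue_number_lemma_of_metric (s := Set.Icc (r : ℝ) s)
    (c := fun U : 𝒰 => ((U : Opens ℝ) : Set ℝ)) isCompact_Icc (fun U => U.1.2) (by
      intro x hx
      have hx' : x ∈ sSup 𝒰 := hpq
        ⟨lt_of_lt_of_le (by exact_mod_cast hpr) hx.1, lt_of_le_of_lt hx.2 (by exact_mod_cast hsq)⟩
      obtain ⟨U, hU, hxU⟩ := Opens.mem_sSup.1 hx'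
      exact Set.mem_iUnion.2 ⟨⟨U, hU⟩, hxU⟩)
  obtain ⟨ε, hε0, hεδ⟩ := exists_rat_btwn hδ
  have hε : (0 : ℚ) < ε := by exact_mod_cast hε0
  have small : ∀ x ∈ Set.Icc r s, ρ (x - ε) (x + ε) ≤ B := by
    intro x hx
    obtain ⟨U, hU⟩ := hcov x ⟨by exact_mod_cast hx.1, by exact_mod_cast hx.2⟩
    refine hB U.1 U.2 _ _ ?_
    intro y hy
    apply hU
    have hy' : ((x - ε : ℚ) : ℝ) < y ∧ y < ((x + ε : ℚ) : ℝ) := hy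
    push_cast at hy'
    rw [Metric.mem_ball, Real.dist_eq, abs_lt]
    constructor <;> linarith [hy'.1, hy'.2]
  have step : ∀ n : ℕ, r + n * ε ≤ s → ρ (r - ε) (r + n * ε + ε) ≤ B := by
    intro n
    induction n with
    | zero =>
      intro _
      simpa using small r ⟨le_rfl, hrs.le⟩
    | succ n ih =>
      intro hn
      push_cast at hn ⊢
      have hn0 : (0 : ℚ) ≤ n * ε := by positivity
      have h1 := ih (by linarith)
      have h2 := small (r + (n + 1) * ε) ⟨by linarith, hn⟩
      have h3 : ρ (r + (n + 1) * ε - ε - ε / 2) (r + (n + 1) * ε + ε) ≤ B := by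
        rw [← h.sup_eq (r + (n + 1) * ε - ε - ε / 2) (r + n * ε + ε / 2)
          (r + (n + 1) * ε - ε) _ (by linarith) (by linarith) (by linarith)]
        refine sup_le ((h.mono ?_).trans (small (r + n * ε) ⟨by linarith, by linarith⟩)) h2
        exact Set.Ioo_subset_Ioo (Rat.cast_le.2 (by linarith)) (Rat.cast_le.2 (by linarith))
      rw [← h.sup_eq (r - ε) (r + n * ε + ε) (r + (n + 1) * ε - ε - ε / 2) _
        (by linarith) (by linarith) (by linarith)]
      exact sup_le h1 h3
  obtain ⟨N, hN⟩ := exists_nat_gt ((s - r) / ε)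
  have hN' : s < r + N * ε := by
    have := (div_lt_iff₀ hε).1 hN
    linarith
  classical
  have hex : ∃ n : ℕ, s < r + n * ε := ⟨N, hN'⟩
  obtain ⟨m, hm⟩ : ∃ m, Nat.find hex = m + 1 := by
    refine Nat.exists_eq_succ_of_ne_zero ?_
    intro h0
    have := Nat.find_spec hex
    rw [h0] at this
    norm_num at this
    linarith
  have hm1 : s < r + (m + 1) * ε := by
    have := Nat.find_spec hex
    rw [hm] at this
    exact_mod_cast this
  have hm2 : r + m * ε ≤ s := not_lt.1 (Nat.find_min hex (by omega))
  refine (h.mono ?_).trans (step m hm2)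
  exact Set.Ioo_subset_Ioo (Rat.cast_le.2 (by linarith)) (Rat.cast_le.2 (by linarith))

theorem eq_sSup_ioo (U : Opens ℝ) :
    U = sSup {V | ∃ p q : ℚ, ioo p q ≤ U ∧ V = ioo p q} := by
  apply le_antisymm
  · intro x hx
    obtain ⟨a, b, hab, hsub⟩ := (mem_nhds_iff_exists_Ioo_subset).1 (U.2.mem_nhds hx)
    obtain ⟨p, hp1, hp2⟩ := exists_rat_btwn hab.1
    obtain ⟨q, hq1, hq2⟩ := exists_rat_btwn hab.2
    refine Opens.mem_sSup.2 ⟨ioo p q, ⟨p, q, ?_, rfl⟩, ⟨hp2, hq1⟩⟩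
    exact (Set.Ioo_subset_Ioo hp1.le hq2.le).trans hsub
  · refine sSup_le ?_
    rintro V ⟨p, q, h, rfl⟩
    exact h

/-- The rational open intervals satisfy the defining relations of the frame of reals. -/
theorem realRelations_ioo : RealRelations (fun p q : ℚ => ioo p q) where
  inf_eq p q r s := by
    ext x
    change (_ ∧ _) ∧ (_ ∧ _) ↔ _ ∧ _
    push_cast
    rw [max_lt_iff, lt_min_iff]
    tauto
  sup_eq p q r s h1 h2 h3 := by
    have h1' : (p : ℝ) ≤ r := by exact_mod_cast h1
    have h2' : (r : ℝ) < q := by exact_mod_cast h2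
    have h3' : (q : ℝ) ≤ s := by exact_mod_cast h3
    ext x
    change (_ ∧ _) ∨ (_ ∧ _) ↔ _ ∧ _
    constructor
    · rintro (⟨h4, h5⟩ | ⟨h4, h5⟩) <;> constructor <;> linarith
    · rintro ⟨h4, h5⟩
      rcases lt_or_ge x q with h6 | h6
      · exact Or.inl ⟨h4, h6⟩
      · exact Or.inr ⟨by linarith, h5⟩
  eq_sSup p q := by
    refine le_antisymm ?_ (sSup_le ?_)
    · intro x hx
      obtain ⟨r, hr1, hr2⟩ := exists_rat_btwn hx.1
      obtain ⟨s, hs1, hs2⟩ := exists_rat_btwn hx.2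
      exact Opens.mem_sSup.2 ⟨ioo r s, ⟨r, s, by exact_mod_cast hr1,
        by exact_mod_cast hr2.trans hs1, by exact_mod_cast hs2, rfl⟩, ⟨hr2, hs1⟩⟩
    · rintro _ ⟨r, s, h1, -, h3, rfl⟩
      exact Set.Ioo_subset_Ioo (Rat.cast_le.2 h1.le) (Rat.cast_le.2 h3.le)
  top_eq := by
    refine le_antisymm ?_ le_top
    intro x _
    obtain ⟨r, hr⟩ := exists_rat_lt x
    obtain ⟨s, hs⟩ := exists_rat_gt x
    exact Opens.mem_iSup.2 ⟨r, Opens.mem_iSup.2 ⟨s, ⟨hr, hs⟩⟩⟩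

/-- The open sets of `ℝ` form the frame of reals: every interpretation of the generators
`(p, q)` that satisfies the defining relations comes from exactly one frame homomorphism. -/
theorem existsUnique_of_relations (ρ : ℚ → ℚ → L) (h : RealRelations ρ) :
    ∃! φ : RealFun L, ∀ p q : ℚ, φ (ioo p q) = ρ p q := by
  let F : Opens ℝ → L := fun U => sSup {x | ∃ p q : ℚ, ioo p q ≤ U ∧ x = ρ p q}
  have hmem : ∀ {U : Opens ℝ} {p q : ℚ}, ioo p q ≤ U → ρ p q ≤ F U :=
    fun {U p q} hU => le_sSup ⟨p, q, hU, rfl⟩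
  have hmono : ∀ {U V : Opens ℝ}, U ≤ V → F U ≤ F V := by
    intro U V hUV
    refine sSup_le ?_
    rintro x ⟨p, q, hx, rfl⟩
    exact hmem (hx.trans hUV)
  let φ : RealFun L :=
    { toFun := F
      map_inf' := by
        intro U V
        refine le_antisymm (le_inf (hmono inf_le_left) (hmono inf_le_right)) ?_
        change sSup _ ⊓ sSup _ ≤ _
        rw [sSup_inf_sSup]
        refine iSup₂_le ?_
        rintro ⟨x, y⟩ ⟨⟨p, q, hx, hx'⟩, ⟨r, s, hy, hy'⟩⟩
        simp only at hx' hy'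
        subst hx' hy'
        simp only
        rw [h.inf_eq]
        refine hmem ?_
        intro z hz
        have hz' : ((max p r : ℚ) : ℝ) < z ∧ z < ((min q s : ℚ) : ℝ) := hz
        push_cast at hz'
        rw [max_lt_iff, lt_min_iff] at hz'
        exact ⟨hx ⟨hz'.1.1, hz'.2.1⟩, hy ⟨hz'.1.2, hz'.2.2⟩⟩
      map_top' := by
        refine top_le_iff.1 ?_
        rw [h.top_eq]
        exact iSup₂_le fun p q => hmem le_top
      map_sSup' := by
        intro 𝒰
        refine le_antisymm ?_ ?_
        · refine sSup_le ?_
          rintro x ⟨p, q, hx, rfl⟩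
          refine h.le_of_cover 𝒰 _ ?_ p q hx
          intro U hU r s hrs
          exact (hmem hrs).trans (le_sSup ⟨U, hU, rfl⟩)
        · refine sSup_le ?_
          rintro x ⟨U, hU, rfl⟩
          exact hmono (le_sSup hU) }
  refine ⟨φ, ?_, ?_⟩
  · intro p q
    refine le_antisymm ?_ (hmem le_rfl)
    refine sSup_le ?_
    rintro x ⟨r, s, hrs, rfl⟩
    exact h.mono hrs
  · intro ψ hψ
    ext U
    change ψ U = sSup _
    conv_lhs => rw [eq_sSup_ioo U]
    rw [map_sSup]
    congr 1
    ext x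
    constructor
    · rintro ⟨V, ⟨p, q, hV, rfl⟩, rfl⟩
      exact ⟨p, q, hV, hψ p q⟩
    · rintro ⟨p, q, hV, rfl⟩
      exact ⟨_, ⟨p, q, hV, rfl⟩, hψ p q⟩

end Presentation

/-! ### The ring structure of `ℛL` -/

section Pairing

variable {L : Type u} [Order.Frame L]
variable {X Y Z : Type*} [TopologicalSpace X] [TopologicalSpace Y] [TopologicalSpace Z]

/-- The open box `V × W`. -/
def box (V : Opens X) (W : Opens Y) : Opens (X × Y) :=
  ⟨(V : Set X) ×ˢ (W : Set Y), V.2.prod W.2⟩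

/-- The value at `U` of the homomorphism induced by `φ` and `ψ` on the opens of the product:
the join of all `φ V ∧ ψ W` with `V × W ⊆ U`. -/
def pairFun (φ : FrameHom (Opens X) L) (ψ : FrameHom (Opens Y) L) (U : Opens (X × Y)) : L :=
  sSup {x | ∃ (V : Opens X) (W : Opens Y), box V W ≤ U ∧ x = φ V ⊓ ψ W}

theorem le_pairFun (φ : FrameHom (Opens X) L) (ψ : FrameHom (Opens Y) L) {U : Opens (X × Y)}
    {V : Opens X} {W : Opens Y} (h : box V W ≤ U) : φ V ⊓ ψ W ≤ pairFun φ ψ U :=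
  le_sSup ⟨V, W, h, rfl⟩

theorem pairFun_mono (φ : FrameHom (Opens X) L) (ψ : FrameHom (Opens Y) L)
    {U U' : Opens (X × Y)} (h : U ≤ U') : pairFun φ ψ U ≤ pairFun φ ψ U' := by
  refine sSup_le ?_
  rintro x ⟨V, W, hVW, rfl⟩
  exact le_pairFun φ ψ (hVW.trans h)

theorem pairFun_cover [LocallyCompactSpace X] (φ : FrameHom (Opens X) L)
    (ψ : FrameHom (Opens Y) L) (𝒰 : Set (Opens (X × Y))) (B : L)
    (hB : ∀ U ∈ 𝒰, pairFun φ ψ U ≤ B) (V : Opens X) (W : Opens Y)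
    (hVW : box V W ≤ sSup 𝒰) : φ V ⊓ ψ W ≤ B := by
  have key : ∀ (K : Set X), IsCompact K → K ⊆ V → ∀ y ∈ W,
      ∃ (V₀ : Opens X) (W₀ : Opens Y), K ⊆ V₀ ∧ y ∈ W₀ ∧ φ V₀ ⊓ ψ W₀ ≤ B := by
    intro K hK hKV y hy
    refine hK.induction_on (p := fun S => ∃ (V₀ : Opens X) (W₀ : Opens Y),
      S ⊆ V₀ ∧ y ∈ W₀ ∧ φ V₀ ⊓ ψ W₀ ≤ B) ?_ ?_ ?_ ?_
    · exact ⟨⊥, ⊤, Set.empty_subset _, trivial, by simp⟩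
    · rintro s t hst ⟨V₀, W₀, h1, h2, h3⟩
      exact ⟨V₀, W₀, hst.trans h1, h2, h3⟩
    · rintro s t ⟨V₀, W₀, h1, h2, h3⟩ ⟨V₁, W₁, h4, h5, h6⟩
      refine ⟨V₀ ⊔ V₁, W₀ ⊓ W₁, ?_, ⟨h2, h5⟩, ?_⟩
      · rw [Opens.coe_sup]
        exact Set.union_subset_union h1 h4
      · rw [map_sup, map_inf, inf_sup_right]
        exact sup_le (le_trans (inf_le_inf_left _ inf_le_left) h3)
          (le_trans (inf_le_inf_left _ inf_le_right) h6)
    · intro x hx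
      have hxy : (x, y) ∈ sSup 𝒰 := hVW ⟨hKV hx, hy⟩
      obtain ⟨U, hU, hxyU⟩ := Opens.mem_sSup.1 hxy
      obtain ⟨s, t, hs, ht, hxs, hyt, hst⟩ := isOpen_prod_iff.1 U.2 x y hxyU
      refine ⟨s, mem_nhdsWithin_of_mem_nhds (hs.mem_nhds hxs), ⟨s, hs⟩, ⟨t, ht⟩,
        subset_rfl, hyt, ?_⟩
      exact (le_pairFun φ ψ (V := ⟨s, hs⟩) (W := ⟨t, ht⟩) hst).trans (hB U hU)
  have hV : V = sSup {V' : Opens X | ∃ K : Set X, IsCompact K ∧ K ⊆ V ∧ (V' : Set X) ⊆ K} := by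
    refine le_antisymm ?_ ?_
    · intro x hx
      obtain ⟨K, hK, hxK, hKV⟩ := exists_compact_subset V.2 hx
      exact Opens.mem_sSup.2 ⟨⟨interior K, isOpen_interior⟩, ⟨K, hK, hKV, interior_subset⟩, hxK⟩
    · refine sSup_le ?_
      rintro V' ⟨K, -, h1, h2⟩
      exact h2.trans h1
  rw [hV, map_sSup, sSup_inf_eq]
  refine iSup₂_le ?_
  rintro _ ⟨V', ⟨K, hK, hKV, hV'K⟩, rfl⟩
  have hW : W ≤ sSup {W' : Opens Y | φ V' ⊓ ψ W' ≤ B} := by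
    intro y hy
    obtain ⟨V₀, W₀, h1, h2, h3⟩ := key K hK hKV y hy
    refine Opens.mem_sSup.2 ⟨W₀, ?_, h2⟩
    exact (inf_le_inf_right _ (OrderHomClass.mono φ (hV'K.trans h1))).trans h3
  refine (inf_le_inf_left _ (OrderHomClass.mono ψ hW)).trans ?_
  rw [map_sSup, inf_sSup_eq]
  refine iSup₂_le ?_
  rintro _ ⟨W', hW', rfl⟩
  exact hW'

/-- The homomorphism on the opens of a product induced by homomorphisms on the opens of the
factors. -/
def pair [LocallyCompactSpace X] (φ : FrameHom (Opens X) L) (ψ : FrameHom (Opens Y) L) :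
    FrameHom (Opens (X × Y)) L where
  toFun := pairFun φ ψ
  map_inf' := by
    intro U U'
    refine le_antisymm
      (le_inf (pairFun_mono φ ψ inf_le_left) (pairFun_mono φ ψ inf_le_right)) ?_
    rw [pairFun, pairFun, sSup_inf_sSup]
    refine iSup₂_le ?_
    rintro ⟨x, y⟩ ⟨⟨V, W, hVW, hx⟩, ⟨V', W', hVW', hy⟩⟩
    simp only at hx hy
    subst hx hy
    simp only
    rw [inf_inf_inf_comm, ← map_inf, ← map_inf]
    refine le_pairFun φ ψ ?_
    rintro ⟨a, b⟩ ⟨ha, hb⟩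
    exact ⟨hVW ⟨ha.1, hb.1⟩, hVW' ⟨ha.2, hb.2⟩⟩
  map_top' := by
    refine top_le_iff.1 ?_
    refine le_trans ?_ (le_pairFun φ ψ (U := ⊤) (V := ⊤) (W := ⊤) le_top)
    simp
  map_sSup' := by
    intro 𝒰
    refine le_antisymm ?_ ?_
    · refine sSup_le ?_
      rintro x ⟨V, W, hVW, rfl⟩
      refine pairFun_cover φ ψ 𝒰 _ (fun U hU => ?_) V W hVW
      exact le_sSup ⟨U, hU, rfl⟩
    · refine sSup_le ?_
      rintro x ⟨U, hU, rfl⟩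
      exact pairFun_mono φ ψ (le_sSup hU)

/-- A homomorphism on the opens of a product is determined by its two restrictions. -/
theorem hom_ext_prod {θ θ' : FrameHom (Opens (X × Y)) L}
    (h₁ : θ.comp (Opens.comap ContinuousMap.fst) = θ'.comp (Opens.comap ContinuousMap.fst))
    (h₂ : θ.comp (Opens.comap ContinuousMap.snd) = θ'.comp (Opens.comap ContinuousMap.snd)) :
    θ = θ' := by
  ext U
  have hbox : ∀ (V : Opens X) (W : Opens Y), θ (box V W) = θ' (box V W) := by
    intro V W
    have e : box V W = Opens.comap ContinuousMap.fst V ⊓ Opens.comap ContinuousMap.snd W := rfl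
    rw [e, map_inf, map_inf]
    exact congrArg₂ (· ⊓ ·) (DFunLike.congr_fun h₁ V) (DFunLike.congr_fun h₂ W)
  have hU : U = sSup {U' | ∃ (V : Opens X) (W : Opens Y), box V W ≤ U ∧ U' = box V W} := by
    refine le_antisymm ?_ ?_
    · rintro ⟨x, y⟩ hxy
      obtain ⟨s, t, hs, ht, hxs, hyt, hst⟩ := isOpen_prod_iff.1 U.2 x y hxy
      exact Opens.mem_sSup.2 ⟨_, ⟨⟨s, hs⟩, ⟨t, ht⟩, hst, rfl⟩, ⟨hxs, hyt⟩⟩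
    · refine sSup_le ?_
      rintro _ ⟨V, W, h, rfl⟩
      exact h
  rw [hU, map_sSup, map_sSup]
  congr 1
  refine Set.image_congr ?_
  rintro _ ⟨V, W, -, rfl⟩
  exact hbox V W

theorem pair_fst [LocallyCompactSpace X] (φ : FrameHom (Opens X) L)
    (ψ : FrameHom (Opens Y) L) : (pair φ ψ).comp (Opens.comap ContinuousMap.fst) = φ := by
  ext V
  change pairFun φ ψ _ = φ V
  refine le_antisymm (sSup_le ?_) ?_
  · rintro _ ⟨V', W, h, rfl⟩
    by_cases hW : (W : Set Y).Nonempty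
    · obtain ⟨y, hy⟩ := hW
      refine inf_le_left.trans (OrderHomClass.mono φ ?_)
      intro x hx
      exact h (show (x, y) ∈ box V' W from ⟨hx, hy⟩)
    · have : W = ⊥ := by
        ext y
        simpa using fun hy => hW ⟨y, hy⟩
      rw [this, map_bot, inf_bot_eq]
      exact bot_le
  · have : φ V ⊓ ψ ⊤ ≤ pairFun φ ψ (Opens.comap ContinuousMap.fst V) :=
      le_pairFun φ ψ (fun x hx => hx.1)
    simpa using this

theorem pair_snd [LocallyCompactSpace X] (φ : FrameHom (Opens X) L)
    (ψ : FrameHom (Opens Y) L) : (pair φ ψ).comp (Opens.comap ContinuousMap.snd) = ψ := by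
  ext W
  change pairFun φ ψ _ = ψ W
  refine le_antisymm (sSup_le ?_) ?_
  · rintro _ ⟨V, W', h, rfl⟩
    by_cases hV : (V : Set X).Nonempty
    · obtain ⟨x, hx⟩ := hV
      refine inf_le_right.trans (OrderHomClass.mono ψ ?_)
      intro y hy
      exact h (show (x, y) ∈ box V W' from ⟨hx, hy⟩)
    · have : V = ⊥ := by
        ext x
        simpa using fun hx => hV ⟨x, hx⟩
      rw [this, map_bot, bot_inf_eq]
      exact bot_le
  · have : φ ⊤ ⊓ ψ W ≤ pairFun φ ψ (Opens.comap ContinuousMap.snd W) :=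
      le_pairFun φ ψ (fun x hx => hx.2)
    simpa using this

theorem pair_comap [LocallyCompactSpace X] (θ : FrameHom (Opens Z) L) (f : C(Z, X))
    (g : C(Z, Y)) : pair (θ.comp (Opens.comap f)) (θ.comp (Opens.comap g)) =
      θ.comp (Opens.comap (f.prodMk g)) :=
  hom_ext_prod (by rw [pair_fst]; rfl) (by rw [pair_snd]; rfl)

end Pairing

namespace RealFun

variable {L : Type u} [Order.Frame L]

/-- The operation on `ℛL` given by a continuous binary operation `f` on the reals:
`U` is sent to the join of all `α V ∧ β W` with `f (V × W) ⊆ U`. -/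
def binop (f : C(ℝ × ℝ, ℝ)) (α β : RealFun L) : RealFun L :=
  (pair α β).comp (Opens.comap f)

theorem binop_apply (f : C(ℝ × ℝ, ℝ)) (α β : RealFun L) (U : Opens ℝ) :
    binop f α β U =
      sSup {x | ∃ V W : Opens ℝ, (∀ v ∈ V, ∀ w ∈ W, f (v, w) ∈ U) ∧ x = α V ⊓ β W} := by
  change sSup _ = _
  congr 1
  ext x
  refine exists_congr fun V => exists_congr fun W => and_congr_left fun _ => ?_
  exact ⟨fun h v hv w hw => h (show (v, w) ∈ box V W from ⟨hv, hw⟩),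
    fun h p hp => h p.1 hp.1 p.2 hp.2⟩

/-- The constant function `r`: it sends `U` to `1` if `r ∈ U` and to `0` otherwise. -/
def const (r : ℝ) : RealFun L where
  toFun U := ⨆ _ : r ∈ U, ⊤
  map_inf' := by
    intro U V
    by_cases hU : r ∈ U <;> by_cases hV : r ∈ V <;> simp [hU, hV]
  map_top' := by simp
  map_sSup' := by
    intro 𝒰
    refine le_antisymm (iSup_le fun h => ?_) (sSup_le ?_)
    · obtain ⟨U, hU, hr⟩ := Opens.mem_sSup.1 h
      refine le_trans ?_ (le_sSup ⟨U, hU, rfl⟩)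
      simp [hr]
    · rintro _ ⟨U, hU, rfl⟩
      exact iSup_le fun h => le_iSup_of_le (Opens.mem_sSup.2 ⟨U, hU, h⟩) le_rfl

instance : Zero (RealFun L) := ⟨const 0⟩

instance : One (RealFun L) := ⟨const 1⟩

instance : Add (RealFun L) := ⟨binop ⟨fun x => x.1 + x.2, by fun_prop⟩⟩

instance : Mul (RealFun L) := ⟨binop ⟨fun x => x.1 * x.2, by fun_prop⟩⟩

instance : Neg (RealFun L) := ⟨fun α => α.comp (Opens.comap ⟨fun x => -x, by fun_prop⟩)⟩

variable {Z : Type*} [TopologicalSpace Z]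

theorem comap_add (θ : FrameHom (Opens Z) L) (f g : C(Z, ℝ)) :
    (θ.comp (Opens.comap f) + θ.comp (Opens.comap g) : RealFun L) =
      θ.comp (Opens.comap (f + g)) :=
  congrArg (fun η : FrameHom (Opens (ℝ × ℝ)) L =>
    η.comp (Opens.comap ⟨fun x => x.1 + x.2, by fun_prop⟩)) (pair_comap θ f g)

theorem comap_mul (θ : FrameHom (Opens Z) L) (f g : C(Z, ℝ)) :
    (θ.comp (Opens.comap f) * θ.comp (Opens.comap g) : RealFun L) =
      θ.comp (Opens.comap (f * g)) :=
  congrArg (fun η : FrameHom (Opens (ℝ × ℝ)) L =>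
    η.comp (Opens.comap ⟨fun x => x.1 * x.2, by fun_prop⟩)) (pair_comap θ f g)

theorem comap_neg (θ : FrameHom (Opens Z) L) (f : C(Z, ℝ)) :
    (-(θ.comp (Opens.comap f) : RealFun L)) = θ.comp (Opens.comap (-f)) := rfl

theorem comap_const (θ : FrameHom (Opens Z) L) (r : ℝ) :
    (const r : RealFun L) = θ.comp (Opens.comap (ContinuousMap.const Z r)) := by
  ext U
  change (⨆ _ : r ∈ U, ⊤) = θ (Opens.comap (ContinuousMap.const Z r) U)
  by_cases h : r ∈ U
  · have : Opens.comap (ContinuousMap.const Z r) U = ⊤ := by ext; simpa using h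
    rw [this]; simp [h]
  · have : Opens.comap (ContinuousMap.const Z r) U = ⊥ := by ext; simpa using h
    rw [this]; simp [h]

theorem comap_zero (θ : FrameHom (Opens Z) L) :
    (0 : RealFun L) = θ.comp (Opens.comap (0 : C(Z, ℝ))) := comap_const θ 0

theorem comap_one (θ : FrameHom (Opens Z) L) :
    (1 : RealFun L) = θ.comp (Opens.comap (1 : C(Z, ℝ))) := comap_const θ 1

/-- Any three elements of `ℛL` come from one homomorphism on the opens of `ℝ³`. -/
theorem exists_comap (α β γ : RealFun L) :
    ∃ (θ : FrameHom (Opens (ℝ × ℝ × ℝ)) L) (f g h : C(ℝ × ℝ × ℝ, ℝ)),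
      α = θ.comp (Opens.comap f) ∧ β = θ.comp (Opens.comap g) ∧ γ = θ.comp (Opens.comap h) := by
  refine ⟨pair α (pair β γ), ContinuousMap.fst, ContinuousMap.fst.comp ContinuousMap.snd,
    ContinuousMap.snd.comp ContinuousMap.snd, (pair_fst _ _).symm, ?_, ?_⟩
  · exact ((congrArg (fun η => η.comp (Opens.comap ContinuousMap.fst))
      (pair_snd α (pair β γ))).trans (pair_fst β γ)).symm
  · exact ((congrArg (fun η => η.comp (Opens.comap ContinuousMap.snd))
      (pair_snd α (pair β γ))).trans (pair_snd β γ)).symm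

/-- The commutative ring `ℛL`. -/
instance : CommRing (RealFun L) where
  add_assoc α β γ := by
    obtain ⟨θ, f, g, h, rfl, rfl, rfl⟩ := exists_comap α β γ
    simp only [comap_add, add_assoc]
  zero_add α := by
    obtain ⟨θ, f, g, h, rfl, -, -⟩ := exists_comap α α α
    rw [comap_zero θ, comap_add, zero_add]
  add_zero α := by
    obtain ⟨θ, f, g, h, rfl, -, -⟩ := exists_comap α α α
    rw [comap_zero θ, comap_add, add_zero]
  add_comm α β := by
    obtain ⟨θ, f, g, h, rfl, rfl, -⟩ := exists_comap α β β
    rw [comap_add, comap_add, add_comm]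
  neg_add_cancel α := by
    obtain ⟨θ, f, g, h, rfl, -, -⟩ := exists_comap α α α
    rw [comap_neg, comap_add, comap_zero θ, neg_add_cancel]
  mul_assoc α β γ := by
    obtain ⟨θ, f, g, h, rfl, rfl, rfl⟩ := exists_comap α β γ
    simp only [comap_mul, mul_assoc]
  one_mul α := by
    obtain ⟨θ, f, g, h, rfl, -, -⟩ := exists_comap α α α
    rw [comap_one θ, comap_mul, one_mul]
  mul_one α := by
    obtain ⟨θ, f, g, h, rfl, -, -⟩ := exists_comap α α α
    rw [comap_one θ, comap_mul, mul_one]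
  mul_comm α β := by
    obtain ⟨θ, f, g, h, rfl, rfl, -⟩ := exists_comap α β β
    rw [comap_mul, comap_mul, mul_comm]
  left_distrib α β γ := by
    obtain ⟨θ, f, g, h, rfl, rfl, rfl⟩ := exists_comap α β γ
    simp only [comap_mul, comap_add, mul_add]
  right_distrib α β γ := by
    obtain ⟨θ, f, g, h, rfl, rfl, rfl⟩ := exists_comap α β γ
    simp only [comap_mul, comap_add, add_mul]
  zero_mul α := by
    obtain ⟨θ, f, g, h, rfl, -, -⟩ := exists_comap α α α
    rw [comap_zero θ, comap_mul, zero_mul]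
  mul_zero α := by
    obtain ⟨θ, f, g, h, rfl, -, -⟩ := exists_comap α α α
    rw [comap_zero θ, comap_mul, mul_zero]
  nsmul := nsmulRec
  zsmul := zsmulRec

end RealFun

/-! ### Cozero elements, `P_F`-frames, `z`-ideals -/

section Main

variable {L : Type u} [Order.Frame L]

/-- The cozero map: `coz φ` is the join of all `φ (p, 0) ∨ φ (0, q)` with `p, q` rational. -/
def coz (φ : RealFun L) : L :=
  ⨆ (p : ℚ) (q : ℚ), φ (ioo p 0) ⊔ φ (ioo 0 q)

/-- A cozero element of `L`. -/
def IsCozero (a : L) : Prop := ∃ φ : RealFun L, coz φ = a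

variable (L) in
/-- `L` is a `P_F`-frame: of any two disjoint cozero elements, one is complemented. -/
def IsPFFrame : Prop :=
  ∀ a b : L, IsCozero a → IsCozero b → a ⊓ b = ⊥ → IsComplemented a ∨ IsComplemented b

/-- An ideal of `ℛL` (proper or not) is a `z`-ideal if it contains every element that has the
same cozero element as one of its members. -/
def IsZIdeal (I : Ideal (RealFun L)) : Prop :=
  ∀ α φ : RealFun L, φ ∈ I → coz α = coz φ → α ∈ I

end Main

end PointFree

namespace PointFree

universe u

variable {L : Type u} [Order.Frame L]

/-! ### Functions on a space and elements of `ℛL` -/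

section Calculus

variable {Z : Type*} [TopologicalSpace Z]

/-! Finitely many elements of `ℛL` are images of continuous functions on one space `Z` under one
frame homomorphism `θ`, so identities in `ℛL` reduce to pointwise ones. When a pointwise
construction needs a division, `θ` is first factored through the subspace where the division makes
sense (`exists_lift_of_le`), or the quotient is made continuous by bounding it.

From the `P_F` condition: write `φ² - ψ² = p² - m²` with `pm = 0`. One of `coz p`, `coz m` is
complemented, say `coz p = coz e` with `e` idempotent. Then `φ` divides `e`, while away from `e` one
has `ψ² = φ² + m²`, so `ψ` divides `φ²` there (`IsPFFrame.exists_idempotent`,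
`dvd_one_sub_mul_mul_self`). If neither `I` nor `J` is a `z`-ideal, comparing two witnesses of the
failure in this way puts one of them back in its ideal. For `I ⊓ J` the comparison is direct; for `I
⊔ J` the witness for each ideal is first moved into the other one.

Towards the `P_F` condition: if the principal ideal of `f` contains a cube root of `f`, then `coz f`
is complemented. For disjoint `coz f`, `coz g` the principal ideals meet in zero, a `z`-ideal.
Enlarged by `cozIdeal (coz g)` and `cozIdeal (coz f)` respectively, they have the `z`-ideal
`cozIdeal (coz f ⊔ coz g)` as sum. In either case one of the two ideals is a `z`-ideal, hence
contains the cube root, and disjointness shows that the enlargement contributes nothing to it. -/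

/-- The open set of nonzero reals. -/
def nonzero : Opens ℝ := ⟨{0}ᶜ, isOpen_compl_singleton⟩

theorem coz_eq (φ : RealFun L) : coz φ = φ nonzero := by
  have h : nonzero = ⨆ (p : ℚ) (q : ℚ), ioo p 0 ⊔ ioo 0 q := by
    refine le_antisymm ?_ (iSup₂_le fun p q => sup_le ?_ ?_)
    · intro x hx
      obtain ⟨p, hp⟩ := exists_rat_lt x
      obtain ⟨q, hq⟩ := exists_rat_gt x
      refine Opens.mem_iSup.2 ⟨p, Opens.mem_iSup.2 ⟨q, ?_⟩⟩
      rcases lt_or_gt_of_ne (show x ≠ 0 from hx) with h | h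
      · exact Or.inl ⟨hp, h⟩
      · exact Or.inr ⟨h, hq⟩
    · exact fun x hx => ne_of_lt hx.2
    · exact fun x hx => ne_of_gt hx.1
  rw [h, coz]
  simp only [map_iSup, map_sup]

theorem coz_comap (θ : FrameHom (Opens Z) L) (f : C(Z, ℝ)) :
    coz (θ.comp (Opens.comap f) : RealFun L) = θ (Opens.comap f nonzero) := coz_eq _

theorem coz_comap_mono (θ : FrameHom (Opens Z) L) {f g : C(Z, ℝ)}
    (h : ∀ z, g z = 0 → f z = 0) :
    coz (θ.comp (Opens.comap f) : RealFun L) ≤ coz (θ.comp (Opens.comap g) : RealFun L) := by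
  rw [coz_comap, coz_comap]
  exact OrderHomClass.mono θ fun z hz hg => hz (h z hg)

theorem coz_comap_congr (θ : FrameHom (Opens Z) L) {f g : C(Z, ℝ)}
    (h : ∀ z, g z = 0 ↔ f z = 0) :
    coz (θ.comp (Opens.comap f) : RealFun L) = coz (θ.comp (Opens.comap g) : RealFun L) :=
  le_antisymm (coz_comap_mono θ fun z => (h z).1) (coz_comap_mono θ fun z => (h z).2)

/-- The preimages of `U` differ only inside the cozero set of `k`, which `θ` sends to `⊥`. -/
theorem comap_le_of_disjoint (θ : FrameHom (Opens Z) L) {f g k : C(Z, ℝ)}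
    (hk : coz (θ.comp (Opens.comap k) : RealFun L) = ⊥)
    (h : ∀ z, k z = 0 → f z = g z) (U : Opens ℝ) :
    θ (Opens.comap f U) ≤ θ (Opens.comap g U) := by
  rw [coz_comap] at hk
  have : Opens.comap f U ≤ Opens.comap g U ⊔ Opens.comap k nonzero := by
    intro z hz
    by_cases hkz : k z = 0
    · exact Or.inl (show g z ∈ U from h z hkz ▸ hz)
    · exact Or.inr hkz
  simpa [hk] using OrderHomClass.mono θ this

/-- Functions that agree where `k` vanishes induce the same element if `k` induces zero. -/
theorem comap_congr (θ : FrameHom (Opens Z) L) {f g k : C(Z, ℝ)}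
    (hk : coz (θ.comp (Opens.comap k) : RealFun L) = ⊥) (h : ∀ z, k z = 0 → f z = g z) :
    (θ.comp (Opens.comap f) : RealFun L) = θ.comp (Opens.comap g) := by
  ext U
  exact le_antisymm (comap_le_of_disjoint θ hk h U)
    (comap_le_of_disjoint θ hk (fun z hz => (h z hz).symm) U)

theorem comap_sub (θ : FrameHom (Opens Z) L) (f g : C(Z, ℝ)) :
    (θ.comp (Opens.comap f) - θ.comp (Opens.comap g) : RealFun L) =
      θ.comp (Opens.comap (f - g)) := by
  rw [sub_eq_add_neg, RealFun.comap_neg, RealFun.comap_add, sub_eq_add_neg]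

theorem comap_id (φ : RealFun L) : φ = φ.comp (Opens.comap (ContinuousMap.id ℝ)) := rfl

theorem coz_zero : coz (0 : RealFun L) = ⊥ := by
  rw [RealFun.comap_zero (0 : RealFun L), coz_comap, ← map_bot (0 : RealFun L)]
  congr 1
  ext x
  simp [nonzero]

theorem coz_one : coz (1 : RealFun L) = ⊤ := by
  rw [RealFun.comap_one (0 : RealFun L), coz_comap, ← map_top (0 : RealFun L)]
  congr 1
  ext x
  simp [nonzero]

theorem coz_eq_bot {φ : RealFun L} : coz φ = ⊥ ↔ φ = 0 := by
  refine ⟨fun h => ?_, fun h => h ▸ coz_zero⟩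
  rw [RealFun.comap_zero φ]
  exact comap_congr (f := ContinuousMap.id ℝ) (g := 0) (k := ContinuousMap.id ℝ) φ h
    fun z hz => hz

theorem coz_mul (α β : RealFun L) : coz (α * β) = coz α ⊓ coz β := by
  obtain ⟨θ, f, g, -, rfl, rfl, -⟩ := RealFun.exists_comap α β β
  rw [RealFun.comap_mul, coz_comap, coz_comap, coz_comap, ← map_inf]
  congr 1
  ext z
  simp [nonzero]

theorem coz_mul_self (α : RealFun L) : coz (α * α) = coz α := by rw [coz_mul, inf_idem]

theorem coz_neg (α : RealFun L) : coz (-α) = coz α := by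
  rw [comap_id α, RealFun.comap_neg]
  exact coz_comap_congr α fun z => by simp

theorem coz_add_le (α β : RealFun L) : coz (α + β) ≤ coz α ⊔ coz β := by
  obtain ⟨θ, f, g, -, rfl, rfl, -⟩ := RealFun.exists_comap α β β
  rw [RealFun.comap_add, coz_comap, coz_comap, coz_comap, ← map_sup]
  refine OrderHomClass.mono θ fun z hz => ?_
  by_contra hc
  have hc' : ¬ (f z ≠ 0 ∨ g z ≠ 0) := hc
  push Not at hc'
  exact hz (by simp [hc'.1, hc'.2])

theorem coz_add_mul_self (α β : RealFun L) : coz (α * α + β * β) = coz α ⊔ coz β := by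
  refine le_antisymm ?_ (sup_le ?_ ?_)
  · simpa only [coz_mul_self] using coz_add_le (α * α) (β * β)
  all_goals
    obtain ⟨θ, f, g, -, rfl, rfl, -⟩ := RealFun.exists_comap α β β
    rw [RealFun.comap_mul, RealFun.comap_mul, RealFun.comap_add]
    refine coz_comap_mono θ fun z hz => ?_
    simp only [ContinuousMap.add_apply, ContinuousMap.mul_apply] at hz
    nlinarith [mul_self_nonneg (f z), mul_self_nonneg (g z)]

theorem mul_eq_zero_iff_coz {α β : RealFun L} : α * β = 0 ↔ coz α ⊓ coz β = ⊥ := by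
  rw [← coz_eq_bot, coz_mul]

/-- Lets a sum of several squares serve as the single square `k * k` of the domination relations. -/
theorem exists_mul_self_eq_add (h k : RealFun L) : ∃ l : RealFun L, l * l = h * h + k * k := by
  obtain ⟨θ, f, g, -, rfl, rfl, -⟩ := RealFun.exists_comap h k k
  refine ⟨θ.comp (Opens.comap ⟨fun z => √(f z * f z + g z * g z), by fun_prop⟩), ?_⟩
  rw [RealFun.comap_mul, RealFun.comap_mul, RealFun.comap_mul, RealFun.comap_add]
  congr 2
  ext z
  exact Real.mul_self_sqrt (add_nonneg (mul_self_nonneg _) (mul_self_nonneg _))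

/-- Cubing is a homeomorphism of `ℝ`, so cube roots exist for functions of any sign. A `z`-ideal
containing `φ` contains `c` as well. -/
theorem exists_cube_root (φ : RealFun L) : ∃ c : RealFun L, c * c * c = φ ∧ coz c = coz φ := by
  have hodd : Odd 3 := by decide
  let e : ℝ ≃o ℝ := (hodd.strictMono_pow (R := ℝ)).orderIsoOfSurjective _
    ((continuous_pow 3).surjective (Filter.tendsto_pow_atTop (by norm_num))
      (by
        refine Filter.tendsto_neg_atTop_iff.1 ?_
        have := (Filter.tendsto_pow_atTop (α := ℝ) (n := 3) (by norm_num)).comp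
          Filter.tendsto_neg_atBot_atTop
        refine this.congr fun x => ?_
        simp only [Function.comp_apply]
        ring))
  have he : ∀ x, e.symm x * e.symm x * e.symm x = x := fun x => by
    have : (e.symm x) ^ 3 = x := e.apply_symm_apply x
    rw [← pow_two, ← pow_succ, this]
  have hc : φ.comp (Opens.comap ⟨e.symm, e.symm.continuous⟩) *
      φ.comp (Opens.comap ⟨e.symm, e.symm.continuous⟩) *
      φ.comp (Opens.comap ⟨e.symm, e.symm.continuous⟩) = φ := by
    rw [RealFun.comap_mul, RealFun.comap_mul]
    conv_rhs => rw [comap_id φ]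
    congr 2
    ext z
    exact he z
  refine ⟨_, hc, ?_⟩
  conv_rhs => rw [← hc]
  rw [coz_mul, coz_mul, inf_idem, inf_idem]

end Calculus

/-! ### Homomorphisms that factor through a subspace -/

section Lift

variable {Z : Type*} [TopologicalSpace Z]

/-- A homomorphism on the opens of `Z` whose values depend only on the traces on `S` factors
through the opens of `S`. -/
theorem exists_lift (θ : FrameHom (Opens Z) L) (S : Set Z)
    (hS : ∀ U V : Opens Z, (∀ z ∈ S, z ∈ U → z ∈ V) → θ U ≤ θ V) :
    ∃ η : FrameHom (Opens S) L,
      ∀ f : C(Z, ℝ), (θ.comp (Opens.comap f) : RealFun L) =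
        η.comp (Opens.comap (f.restrict S)) := by
  have hex : ∀ W : Opens S, ∃ U : Opens Z, ∀ z : S, (z : Z) ∈ U ↔ z ∈ W := by
    intro W
    obtain ⟨U, hU, hUW⟩ := isOpen_induced_iff.1 W.2
    exact ⟨⟨U, hU⟩, fun z => (Set.ext_iff.1 hUW z)⟩
  -- The extensions `E W` are arbitrary and need not respect meets and joins; their traces on `S`
  -- do, and `hcongr` says that `θ` sees only traces.
  choose E hE using hex
  have hcongr : ∀ U V : Opens Z, (∀ z : S, (z : Z) ∈ U ↔ (z : Z) ∈ V) → θ U = θ V :=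
    fun U V h => le_antisymm (hS U V fun z hz => (h ⟨z, hz⟩).1)
      (hS V U fun z hz => (h ⟨z, hz⟩).2)
  refine ⟨{ toFun := fun W => θ (E W), map_inf' := ?_, map_top' := ?_, map_sSup' := ?_ }, ?_⟩
  · intro W W'
    rw [← map_inf]
    refine hcongr _ _ fun z => ?_
    rw [hE]
    exact and_congr (hE W z).symm (hE W' z).symm
  · rw [← map_top θ]
    refine hcongr _ _ fun z => ?_
    rw [hE]
    exact ⟨fun _ => trivial, fun _ => trivial⟩
  · intro 𝒲
    change θ (E (sSup 𝒲)) = sSup ((fun W => θ (E W)) '' 𝒲)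
    rw [sSup_image, ← map_iSup₂]
    refine hcongr _ _ fun z => ?_
    rw [hE, Opens.mem_sSup]
    simp only [Opens.mem_iSup, hE, exists_prop]
  · intro f
    ext U
    refine hcongr _ _ fun z => ?_
    rw [hE]
    rfl

/-- If `θ K ≤ θ D`, the homomorphism `θ` factors through the subspace where `K` implies `D`. -/
theorem exists_lift_of_le (θ : FrameHom (Opens Z) L) {K D : Opens Z} (h : θ K ≤ θ D) :
    ∃ η : FrameHom (Opens {z | z ∈ K → z ∈ D}) L,
      ∀ f : C(Z, ℝ), (θ.comp (Opens.comap f) : RealFun L) =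
        η.comp (Opens.comap (f.restrict {z | z ∈ K → z ∈ D})) := by
  refine exists_lift θ _ fun U V hUV => ?_
  -- Off `K` the set `U` already lies in `V`; on `K`, the inequality `θ K ≤ θ D` allows `K` to be
  -- replaced by `D`.
  have h1 : U ≤ V ⊔ U ⊓ K := by
    intro z hz
    by_cases hK : z ∈ K
    · exact Or.inr ⟨hz, hK⟩
    · exact Or.inl (hUV z (fun hK' => absurd hK' hK) hz)
  have h2 : U ⊓ D ≤ V := fun z hz => hUV z (fun _ => hz.2) hz.1
  refine (OrderHomClass.mono θ h1).trans ?_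
  rw [map_sup, map_inf]
  refine sup_le le_rfl ((inf_le_inf_left _ h).trans ?_)
  rw [← map_inf]
  exact OrderHomClass.mono θ h2

/-- Such a `φ` factors through the nonzero reals, where inversion is continuous. -/
theorem isUnit_of_coz_eq_top {φ : RealFun L} (h : coz φ = ⊤) : IsUnit φ := by
  rw [coz_eq] at h
  obtain ⟨η, hη⟩ := exists_lift_of_le φ (K := ⊤) (D := nonzero) (by rw [h]; exact le_top)
  have hne : ∀ z : {z : ℝ | z ∈ (⊤ : Opens ℝ) → z ∈ nonzero}, (z : ℝ) ≠ 0 :=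
    fun z => z.2 trivial
  refine IsUnit.of_mul_eq_one (η.comp (Opens.comap ⟨fun z => (z : ℝ)⁻¹,
    continuous_subtype_val.inv₀ hne⟩)) ?_
  conv_lhs => rw [comap_id φ]
  rw [hη, RealFun.comap_mul, RealFun.comap_one η]
  congr 2
  ext z
  exact mul_inv_cancel₀ (hne z)

theorem add_mul_self_ne_zero {a b : ℝ} (h : a ≠ 0 ∨ b ≠ 0) : a * a + b * b ≠ 0 := by
  rw [Ne, mul_self_add_mul_self_eq_zero]
  tauto

/-- At a common zero of `f` and `g` the function `k` vanishes too, and the fraction lies in `[0,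
1]`, so the product is squeezed to zero by `|k|`. -/
theorem continuous_mul_div_add_mul_self {k f g : C(Z, ℝ)}
    (hk : ∀ x, k x ≠ 0 → f x ≠ 0 ∨ g x ≠ 0) :
    Continuous fun x => k x * (f x * f x / (f x * f x + g x * g x)) := by
  refine continuous_iff_continuousAt.2 fun x => ?_
  by_cases hx : f x ≠ 0 ∨ g x ≠ 0
  · have hf := f.continuous.continuousAt (x := x)
    have hg := g.continuous.continuousAt (x := x)
    exact k.continuous.continuousAt.mul
      ((hf.mul hf).div ((hf.mul hf).add (hg.mul hg)) (add_mul_self_ne_zero hx))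
  · have hk0 : k x = 0 := by
      by_contra hk0
      exact hx (hk x hk0)
    have hlim : Filter.Tendsto (fun y => |k y|) (nhds x) (nhds 0) := by
      have := (k.continuous.abs).tendsto x
      simpa [hk0] using this
    simp only [ContinuousAt, hk0, zero_mul]
    refine squeeze_zero_norm (fun y => ?_) hlim
    rw [Real.norm_eq_abs, abs_mul]
    have h1 := mul_self_nonneg (f y)
    have h2 := mul_self_nonneg (g y)
    refine mul_le_of_le_one_right (abs_nonneg _) ?_
    rw [abs_of_nonneg (by positivity)]
    exact div_le_one_of_le₀ (by linarith) (by linarith)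

theorem exists_add_of_ne_zero (η : FrameHom (Opens Z) L) {k f g : C(Z, ℝ)}
    (hk : ∀ x, k x ≠ 0 → f x ≠ 0 ∨ g x ≠ 0) :
    ∃ κ₁ κ₂ : RealFun L, (η.comp (Opens.comap k) : RealFun L) = κ₁ + κ₂ ∧
      coz κ₁ ≤ coz (η.comp (Opens.comap f) : RealFun L) ∧
      coz κ₂ ≤ coz (η.comp (Opens.comap g) : RealFun L) := by
  -- The weights `f² / (f² + g²)` and `g² / (f² + g²)` sum to one wherever `k` is nonzero.
  refine ⟨η.comp (Opens.comap ⟨_, continuous_mul_div_add_mul_self hk⟩),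
    η.comp (Opens.comap ⟨_, continuous_mul_div_add_mul_self fun x hx => (hk x hx).symm⟩),
    ?_, ?_, ?_⟩
  · rw [RealFun.comap_add]
    congr 2
    ext x
    simp only [ContinuousMap.add_apply, ContinuousMap.coe_mk]
    by_cases hx : k x = 0
    · simp [hx]
    · rw [← mul_add, add_comm (g x * g x), ← add_div,
        div_self (add_mul_self_ne_zero (hk x hx)), mul_one]
  · exact coz_comap_mono η fun x hx => by simp [hx]
  · exact coz_comap_mono η fun x hx => by simp [hx]

/-- A function whose cozero element lies below a join of two cozero elements is a sum of
functions whose cozero elements lie below the two. -/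
theorem exists_add_of_coz_le {κ α β : RealFun L} (h : coz κ ≤ coz α ⊔ coz β) :
    ∃ κ₁ κ₂ : RealFun L, κ = κ₁ + κ₂ ∧ coz κ₁ ≤ coz α ∧ coz κ₂ ≤ coz β := by
  obtain ⟨θ, k, f, g, rfl, rfl, rfl⟩ := RealFun.exists_comap κ α β
  rw [coz_comap, coz_comap, coz_comap, ← map_sup] at h
  obtain ⟨η, hη⟩ := exists_lift_of_le θ h
  rw [hη, hη, hη]
  exact exists_add_of_ne_zero η fun x hx => x.2 hx

end Lift

/-! ### Idempotents and divisibility -/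

section Divisibility

/-- The characteristic function of a complemented element. -/
def charFun (c d : L) (h : IsCompl c d) : RealFun L where
  toFun U := (⨆ _ : (1 : ℝ) ∈ U, c) ⊔ ⨆ _ : (0 : ℝ) ∈ U, d
  map_inf' := by
    intro U V
    have h1 := h.inf_eq_bot
    have h2 := h.symm.inf_eq_bot
    have h3 := h.sup_eq_top
    by_cases hU : (1 : ℝ) ∈ U <;> by_cases hV : (1 : ℝ) ∈ V <;> by_cases hU' : (0 : ℝ) ∈ U <;>
      by_cases hV' : (0 : ℝ) ∈ V <;> simp [hU, hV, hU', hV', h1, h2, h3]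
  map_top' := by simpa using h.sup_eq_top
  map_sSup' := by
    intro 𝒰
    refine le_antisymm (sup_le (iSup_le fun hU => ?_) (iSup_le fun hU => ?_)) (sSup_le ?_)
    · obtain ⟨U, hU, hr⟩ := Opens.mem_sSup.1 hU
      refine le_trans ?_ (le_sSup ⟨U, hU, rfl⟩)
      simp [hr]
    · obtain ⟨U, hU, hr⟩ := Opens.mem_sSup.1 hU
      refine le_trans ?_ (le_sSup ⟨U, hU, rfl⟩)
      simp [hr]
    · rintro _ ⟨U, hU, rfl⟩
      exact sup_le_sup
        (iSup_le fun h => le_iSup_of_le (Opens.mem_sSup.2 ⟨U, hU, h⟩) le_rfl)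
        (iSup_le fun h => le_iSup_of_le (Opens.mem_sSup.2 ⟨U, hU, h⟩) le_rfl)

theorem exists_idempotent_of_isComplemented {c : L} (h : IsComplemented c) :
    ∃ e : RealFun L, IsIdempotentElem e ∧ coz e = c := by
  obtain ⟨d, hd⟩ := h
  refine ⟨charFun c d hd, ?_, ?_⟩
  · have h0 : charFun c d hd * charFun c d hd - charFun c d hd = 0 := by
      rw [← coz_eq_bot, comap_id (charFun c d hd), RealFun.comap_mul, comap_sub, coz_comap]
      -- Both joins are empty, because `t * t - t` vanishes at `1` and at `0`.
      change (⨆ _ : _, c) ⊔ (⨆ _ : _, d) = ⊥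
      simp [nonzero, ← SetLike.mem_coe]
    exact sub_eq_zero.1 h0
  · rw [coz_eq]
    change (⨆ _ : _, c) ⊔ (⨆ _ : _, d) = c
    simp [nonzero, ← SetLike.mem_coe]

theorem coz_sup_coz_one_sub (e : RealFun L) : coz e ⊔ coz (1 - e) = ⊤ := by
  rw [← top_le_iff, ← coz_one]
  simpa using coz_add_le e (1 - e)

/-- The sum `u = φ² + (1 - e)²` has cozero element `⊤`, hence is a unit, and `e * u = e * φ²`. -/
theorem dvd_of_coz_le {e φ : RealFun L} (he : IsIdempotentElem e) (h : coz e ≤ coz φ) :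
    φ ∣ e := by
  have hu : IsUnit (φ * φ + (1 - e) * (1 - e)) := by
    apply isUnit_of_coz_eq_top
    rw [coz_add_mul_self, ← top_le_iff, ← coz_sup_coz_one_sub e]
    exact sup_le_sup_right h _
  rw [← hu.dvd_mul_right]
  have he' : e * e = e := he
  exact ⟨e * φ, by linear_combination (e - 2 + 1) * he'⟩

/-- The first equation makes `coz f` disjoint from `coz (1 - g)`; the second gives `coz g ≤ coz f`,
so that the two join to `⊤`. -/
theorem isComplemented_of_mul_eq {f g h : RealFun L} (hg : f = f * g) (hfg : g = f * h) :
    IsComplemented (coz f) := by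
  refine ⟨coz (1 - g), IsCompl.of_eq ?_ ?_⟩
  · rw [← mul_eq_zero_iff_coz]
    linear_combination hg
  · rw [← top_le_iff, ← coz_sup_coz_one_sub g]
    refine sup_le_sup_right ?_ _
    rw [hfg, coz_mul]
    exact inf_le_left

/-- If the principal ideal generated by `f` contains a cube root of `f`, then `coz f` is
complemented. -/
theorem isComplemented_of_dvd_cube_root {f c : RealFun L} (hc : c * c * c = f) (h : f ∣ c) :
    IsComplemented (coz f) := by
  obtain ⟨k, hk⟩ := h
  refine isComplemented_of_mul_eq (g := c * c * k) (h := k * c * k) ?_ ?_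
  · linear_combination c * c * hk - hc
  · linear_combination c * k * hk

/-- The quotient should be `f² / g`, which is bounded by `|g|` where `f² ≤ g²` and so extends
continuously by zero to the zeros of `g`. -/
theorem dvd_mul_self_of_add_mul_self_eq {f g h : RealFun L} (H : f * f + h * h = g * g) :
    g ∣ f * f := by
  rw [← sub_eq_zero, ← coz_eq_bot] at H
  obtain ⟨θ, x, z, y, rfl, rfl, rfl⟩ := RealFun.exists_comap f g h
  simp only [RealFun.comap_mul, RealFun.comap_add, comap_sub] at H
  -- With this `w`, `x² + w²` is `z²` wherever `x² ≤ z²`, so `z * x² / (x² + w²)` is the wanted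
  -- quotient there, while it is continuous on all of `ℝ³`.
  let w : C(ℝ × ℝ × ℝ, ℝ) := ⟨fun p => √(z p * z p - x p * x p), by fun_prop⟩
  have hw : ∀ p, z p ≠ 0 → x p ≠ 0 ∨ w p ≠ 0 := by
    intro p hz
    by_contra! hc
    have := Real.sqrt_eq_zero'.1 hc.2
    rw [hc.1] at this
    have := mul_self_pos.2 hz
    linarith
  refine ⟨θ.comp (Opens.comap ⟨_, continuous_mul_div_add_mul_self hw⟩), ?_⟩
  rw [RealFun.comap_mul, RealFun.comap_mul]
  -- The relation `x² + y² = z²` is available only on the zero set of `x² + y² - z²`; by `H` this is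
  -- enough.
  refine comap_congr θ H fun p hp => ?_
  have hp' : x p * x p + y p * y p - z p * z p = 0 := hp
  have hy := mul_self_nonneg (y p)
  have hwp : w p * w p = z p * z p - x p * x p := Real.mul_self_sqrt (by linarith)
  change x p * x p = z p * (z p * (x p * x p / (x p * x p + w p * w p)))
  rw [hwp, add_sub_cancel]
  by_cases hz : z p = 0
  · have := mul_self_nonneg (x p)
    rw [hz, zero_mul]
    rw [hz] at hp'
    linarith
  · field_simp

/-- A difference of two squares as a difference of two disjoint squares. -/
theorem exists_mul_self_sub_mul_self (φ ψ : RealFun L) :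
    ∃ p m : RealFun L, p * p - m * m = φ * φ - ψ * ψ ∧ p * m = 0 ∧
      coz p ≤ coz φ ∧ coz m ≤ coz ψ := by
  obtain ⟨θ, f, g, -, rfl, rfl, -⟩ := RealFun.exists_comap φ ψ ψ
  -- `√` is zero on negative reals, so these are the square roots of the positive and negative parts
  -- of `f² - g²`.
  refine ⟨θ.comp (Opens.comap ⟨fun z => √(f z * f z - g z * g z), by fun_prop⟩),
    θ.comp (Opens.comap ⟨fun z => √(g z * g z - f z * f z), by fun_prop⟩), ?_, ?_, ?_, ?_⟩
  · simp only [RealFun.comap_mul, comap_sub]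
    congr 2
    ext z
    change √(f z * f z - g z * g z) * √(f z * f z - g z * g z) -
      √(g z * g z - f z * f z) * √(g z * g z - f z * f z) = f z * f z - g z * g z
    rcases le_total (f z * f z) (g z * g z) with h | h
    · rw [Real.sqrt_eq_zero'.2 (sub_nonpos.2 h), Real.mul_self_sqrt (sub_nonneg.2 h)]
      ring
    · rw [Real.sqrt_eq_zero'.2 (sub_nonpos.2 h), Real.mul_self_sqrt (sub_nonneg.2 h)]
      ring
  · rw [RealFun.comap_mul, RealFun.comap_zero θ]
    congr 2
    ext z
    change √(f z * f z - g z * g z) * √(g z * g z - f z * f z) = 0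
    rcases le_total (f z * f z) (g z * g z) with h | h
    · rw [Real.sqrt_eq_zero'.2 (sub_nonpos.2 h), zero_mul]
    · rw [Real.sqrt_eq_zero'.2 (sub_nonpos.2 h), mul_zero]
  · refine coz_comap_mono θ fun z hz => Real.sqrt_eq_zero'.2 ?_
    nlinarith [mul_self_nonneg (g z)]
  · refine coz_comap_mono θ fun z hz => Real.sqrt_eq_zero'.2 ?_
    nlinarith [mul_self_nonneg (f z)]

/-- Take `e` idempotent with cozero element `coz p`. Then `p` vanishes away from `e`, where the
hypothesis becomes `ψ² = φ² + m²`. -/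
theorem exists_idempotent_of_sub_eq {φ ψ p m : RealFun L} (h : p * p - m * m = φ * φ - ψ * ψ)
    (hp : coz p ≤ coz φ) (hc : IsComplemented (coz p)) :
    ∃ e : RealFun L, IsIdempotentElem e ∧ φ ∣ e ∧
      ∃ k, (1 - e) * (ψ * ψ) = (1 - e) * (φ * φ + k * k) := by
  obtain ⟨e, he, hcoz⟩ := exists_idempotent_of_isComplemented hc
  have he' : e * e = e := he
  refine ⟨e, he, dvd_of_coz_le he (hcoz ▸ hp), m, ?_⟩
  have h0 : p * (1 - e) = 0 := by
    rw [mul_eq_zero_iff_coz, ← hcoz, ← mul_eq_zero_iff_coz]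
    linear_combination -he'
  linear_combination (1 - e) * h - p * h0

/-- In a `P_F`-frame, of any two functions one is dominated by the other away from a
complemented element. -/
theorem IsPFFrame.exists_idempotent (hL : IsPFFrame L) (φ ψ : RealFun L) :
    (∃ e : RealFun L, IsIdempotentElem e ∧ φ ∣ e ∧
      ∃ k, (1 - e) * (ψ * ψ) = (1 - e) * (φ * φ + k * k)) ∨
    ∃ e : RealFun L, IsIdempotentElem e ∧ ψ ∣ e ∧
      ∃ k, (1 - e) * (φ * φ) = (1 - e) * (ψ * ψ + k * k) := by
  obtain ⟨p, m, h, hpm, hp, hm⟩ := exists_mul_self_sub_mul_self φ ψ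
  rcases hL _ _ ⟨p, rfl⟩ ⟨m, rfl⟩ (mul_eq_zero_iff_coz.1 hpm) with hc | hc
  · exact Or.inl (exists_idempotent_of_sub_eq h hp hc)
  · exact Or.inr (exists_idempotent_of_sub_eq (m := p) (by linear_combination -h) hm hc)

theorem dvd_one_sub_mul_mul_self {e φ ψ k : RealFun L} (he : IsIdempotentElem e)
    (h : (1 - e) * (ψ * ψ) = (1 - e) * (φ * φ + k * k)) : ψ ∣ (1 - e) * (φ * φ) := by
  have he' : e * e = e := he
  have h1 : (1 - e) * ψ ∣ ((1 - e) * φ) * ((1 - e) * φ) :=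
    dvd_mul_self_of_add_mul_self_eq (h := (1 - e) * k)
      (by linear_combination (e - 1) * h)
  refine (Dvd.intro_left _ rfl).trans (h1.trans (dvd_of_eq ?_))
  linear_combination φ * φ * he'

end Divisibility

/-! ### Sums and intersections that are `z`-ideals -/

section ZIdeals

variable {I J : Ideal (RealFun L)}

theorem exists_of_not_isZIdeal (h : ¬ IsZIdeal I) :
    ∃ α φ : RealFun L, φ ∈ I ∧ coz α = coz φ ∧ α ∉ I := by
  simpa [IsZIdeal] using h

theorem mem_inf_of_idempotent (hz : IsZIdeal (I ⊓ J)) {e α φ ψ k : RealFun L}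
    (he : IsIdempotentElem e) (hφe : φ ∣ e)
    (hk : (1 - e) * (ψ * ψ) = (1 - e) * (φ * φ + k * k))
    (hφ : φ ∈ I) (hψ : ψ ∈ J) (hα : coz α = coz φ) : α ∈ I := by
  -- Away from `e`, `φ²` is a multiple of `ψ` and has the same cozero element as `α`, so the
  -- `z`-property of the intersection applies; on `e`, `α` is a multiple of `φ`.
  have h1 : (1 - e) * (φ * φ) ∈ I ⊓ J :=
    ⟨I.mul_mem_left _ (I.mul_mem_left _ hφ),
      J.mem_of_dvd (dvd_one_sub_mul_mul_self he hk) hψ⟩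
  have h2 : (1 - e) * α ∈ I :=
    (hz _ _ h1 (by rw [coz_mul, coz_mul, coz_mul_self, hα])).1
  have h3 : e * α ∈ I := I.mul_mem_right _ (I.mem_of_dvd hφe hφ)
  have : α = (1 - e) * α + e * α := by ring
  rw [this]
  exact I.add_mem h2 h3

theorem IsPFFrame.isZIdeal_of_inf (hL : IsPFFrame L) (hz : IsZIdeal (I ⊓ J)) :
    IsZIdeal I ∨ IsZIdeal J := by
  by_contra! hc
  obtain ⟨α, φ, hφ, hα, hαI⟩ := exists_of_not_isZIdeal hc.1
  obtain ⟨β, ψ, hψ, hβ, hβJ⟩ := exists_of_not_isZIdeal hc.2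
  rcases hL.exists_idempotent φ ψ with ⟨e, he, hd, k, hk⟩ | ⟨e, he, hd, k, hk⟩
  · exact hαI (mem_inf_of_idempotent hz he hd hk hφ hψ hα)
  · exact hβJ (mem_inf_of_idempotent (inf_comm I J ▸ hz) he hd hk hψ hφ hβ)

/-- If `i² ≤ j²` away from an idempotent `e`, then `j` divides `(i + j)²` away from `e`. -/
theorem dvd_one_sub_mul_add_mul_self {e i j k : RealFun L} (he : IsIdempotentElem e)
    (h : (1 - e) * (j * j) = (1 - e) * (i * i + k * k)) :
    j ∣ (1 - e) * ((i + j) * (i + j)) := by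
  obtain ⟨l, hl⟩ := exists_mul_self_eq_add k k
  obtain ⟨m, hm⟩ := exists_mul_self_eq_add (i - j) l
  -- Away from `e`, `(2j)² = (i + j)² + (i - j)² + 2k²`, and `m²` collects the last two terms.
  refine (Dvd.intro_left 2 rfl).trans (dvd_one_sub_mul_mul_self (ψ := 2 * j) (k := m) he ?_)
  linear_combination 2 * h - (1 - e) * hm - (1 - e) * hl

/-- A cube root `c` of `f` is some `i + j`. Comparing `i` with `j` yields `e`, a multiple of the
one, such that the other divides `(1 - e) * c²`, hence `(1 - e) * f`. -/
theorem IsPFFrame.exists_idempotent_of_mem_sup (hL : IsPFFrame L) (hz : IsZIdeal (I ⊔ J))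
    {f : RealFun L} (hf : f ∈ I ⊔ J) :
    ∃ e : RealFun L, (e ∈ I ∧ (1 - e) * f ∈ J) ∨ (e ∈ J ∧ (1 - e) * f ∈ I) := by
  obtain ⟨c, hc, hcoz⟩ := exists_cube_root f
  obtain ⟨i, hi, j, hj, hij⟩ := Submodule.mem_sup.1 (hz c f hf hcoz)
  have hdvd : ∀ e : RealFun L, (1 - e) * (c * c) ∣ (1 - e) * f :=
    fun e => ⟨c, by rw [← hc]; ring⟩
  rcases hL.exists_idempotent i j with ⟨e, he, hd, k, hk⟩ | ⟨e, he, hd, k, hk⟩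
  · refine ⟨e, Or.inl ⟨I.mem_of_dvd hd hi, J.mem_of_dvd (dvd_trans ?_ (hdvd e)) hj⟩⟩
    rw [← hij]
    exact dvd_one_sub_mul_add_mul_self he hk
  · refine ⟨e, Or.inr ⟨J.mem_of_dvd hd hj, I.mem_of_dvd (dvd_trans ?_ (hdvd e)) hi⟩⟩
    rw [← hij, add_comm]
    exact dvd_one_sub_mul_add_mul_self he hk

/-- If `I + J` is a `z`-ideal and `I` is not, the failure is witnessed inside `J`. -/
theorem IsPFFrame.exists_mem_of_not_isZIdeal (hL : IsPFFrame L) (hz : IsZIdeal (I ⊔ J))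
    (hI : ¬ IsZIdeal I) :
    ∃ φ ∈ I, ∃ a ∈ J, coz a = coz φ ∧ a * a * a ∉ I := by
  obtain ⟨α, φ, hφ, hα, hαI⟩ := exists_of_not_isZIdeal hI
  obtain ⟨a, ha, hcoz⟩ := exists_cube_root α
  have haK : a ∈ I ⊔ J := hz a φ (Ideal.mem_sup_left hφ) (hcoz.trans hα)
  -- Multiplying `a` and `φ` by `1 - e` or by `e` brings `a` into `J`. The part of `α = a³` that
  -- this discards lies in `I`, so the cube of the new `a` stays outside `I`.
  obtain ⟨e, ⟨heI, hJ⟩ | ⟨heJ, hI'⟩⟩ := hL.exists_idempotent_of_mem_sup hz haK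
  · refine ⟨(1 - e) * φ, I.mul_mem_left _ hφ, (1 - e) * a, hJ, ?_, fun h => hαI ?_⟩
    · rw [coz_mul, coz_mul, hcoz, hα]
    · have : α = (1 - e) * a * ((1 - e) * a) * ((1 - e) * a) + (3 - 3 * e + e * e) * α * e := by
        rw [← ha]; ring
      rw [this]
      exact I.add_mem h (I.mul_mem_left _ heI)
  · refine ⟨e * φ, I.mul_mem_left _ hφ, e * a, J.mul_mem_right _ heJ, ?_, fun h => hαI ?_⟩
    · rw [coz_mul, coz_mul, hcoz, hα]
    · have : α = e * a * (e * a) * (e * a) + (1 + e + e * e) * (a * a) * ((1 - e) * a) := by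
        rw [← ha]; ring
      rw [this]
      exact I.add_mem h (I.mul_mem_left _ hI')

/-- Split `a³` along `e`: `φ` divides `e` because `coz e ≤ coz a = coz φ`, and `b` divides `a²` away
from `e`. -/
theorem cube_mem_of_idempotent {e φ a b k : RealFun L} (hφ : φ ∈ I) (hb : b ∈ I)
    (ha : coz a = coz φ) (he : IsIdempotentElem e) (hd : a ∣ e)
    (hk : (1 - e) * (b * b) = (1 - e) * (a * a + k * k)) : a * a * a ∈ I := by
  have hea : coz e ≤ coz φ := by
    obtain ⟨x, rfl⟩ := hd
    rw [coz_mul, ha]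
    exact inf_le_left
  have h1 : e ∈ I := I.mem_of_dvd (dvd_of_coz_le he hea) hφ
  have h2 : (1 - e) * (a * a) ∈ I := I.mem_of_dvd (dvd_one_sub_mul_mul_self he hk) hb
  have : a * a * a = a * ((1 - e) * (a * a)) + a * a * a * e := by ring
  rw [this]
  exact I.add_mem (I.mul_mem_left _ h2) (I.mul_mem_left _ h1)

theorem IsPFFrame.isZIdeal_of_sup (hL : IsPFFrame L) (hz : IsZIdeal (I ⊔ J)) :
    IsZIdeal I ∨ IsZIdeal J := by
  by_contra! hc
  obtain ⟨φ, hφ, a, haJ, ha, haI⟩ := hL.exists_mem_of_not_isZIdeal hz hc.1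
  obtain ⟨ψ, hψ, b, hbI, hb, hbJ⟩ := hL.exists_mem_of_not_isZIdeal (sup_comm I J ▸ hz) hc.2
  rcases hL.exists_idempotent a b with ⟨e, he, hd, k, hk⟩ | ⟨e, he, hd, k, hk⟩
  · exact haI (cube_mem_of_idempotent hφ hbI ha he hd hk)
  · exact hbJ (cube_mem_of_idempotent hψ haJ hb he hd hk)

end ZIdeals

/-! ### Ideals attached to cozero elements -/

section CozIdeals

/-- The ideal of all functions whose cozero element lies below `a`. -/
def cozIdeal (a : L) : Ideal (RealFun L) where
  carrier := {α | coz α ≤ a}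
  add_mem' hα hβ := (coz_add_le _ _).trans (sup_le hα hβ)
  zero_mem' := by
    rw [Set.mem_ofPred_eq, coz_zero]
    exact bot_le
  smul_mem' γ α hα := by
    rw [Set.mem_ofPred_eq, smul_eq_mul, coz_mul]
    exact inf_le_right.trans hα

theorem mem_cozIdeal {a : L} {α : RealFun L} : α ∈ cozIdeal a ↔ coz α ≤ a := Iff.rfl

theorem isZIdeal_cozIdeal (a : L) : IsZIdeal (cozIdeal a) :=
  fun _ _ hφ h => h.trans_le hφ

theorem isZIdeal_bot : IsZIdeal (⊥ : Ideal (RealFun L)) := by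
  intro α φ hφ h
  rw [Ideal.mem_bot] at hφ ⊢
  rw [← coz_eq_bot, h, hφ, coz_zero]

theorem cozIdeal_sup (f g : RealFun L) :
    cozIdeal (coz f ⊔ coz g) = cozIdeal (coz f) ⊔ cozIdeal (coz g) := by
  refine le_antisymm (fun κ hκ => ?_) (sup_le ?_ ?_)
  · obtain ⟨κ₁, κ₂, rfl, h₁, h₂⟩ := exists_add_of_coz_le hκ
    exact Submodule.add_mem_sup h₁ h₂
  · exact fun α hα => le_trans (mem_cozIdeal.1 hα) le_sup_left
  · exact fun α hα => le_trans (mem_cozIdeal.1 hα) le_sup_right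

theorem span_singleton_le_cozIdeal (f : RealFun L) : Ideal.span {f} ≤ cozIdeal (coz f) := by
  rw [Ideal.span_singleton_le_iff_mem]
  exact le_refl (coz f)

/-- If adding to the principal ideal of `f` the functions with cozero element below some `b`
disjoint from `coz f` gives a `z`-ideal, then `coz f` is complemented. -/
theorem isComplemented_of_isZIdeal_sup {f : RealFun L} {b : L} (hfb : coz f ⊓ b = ⊥)
    (hz : IsZIdeal (Ideal.span {f} ⊔ cozIdeal b)) : IsComplemented (coz f) := by
  obtain ⟨c, hc, hcoz⟩ := exists_cube_root f
  have hmem := hz c f (Ideal.mem_sup_left (Ideal.mem_span_singleton_self f)) hcoz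
  obtain ⟨x, hx, y, hy, hxy⟩ := Submodule.mem_sup.1 hmem
  -- In `c = x + y` both `c` and `x` live below `coz f`, hence so does `y`; as `y` also lives below
  -- `b`, it is zero and `f` divides `c`.
  have hy1 : coz y ≤ coz f := by
    have hx' : coz x ≤ coz f := span_singleton_le_cozIdeal f hx
    rw [show y = c + -x by rw [← hxy]; ring]
    refine (coz_add_le _ _).trans (sup_le hcoz.le ?_)
    rw [coz_neg]
    exact hx'
  have hy0 : y = 0 := by
    rw [← coz_eq_bot, ← le_bot_iff, ← hfb]
    exact le_inf hy1 hy
  rw [hy0, add_zero] at hxy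
  exact isComplemented_of_dvd_cube_root hc (Ideal.mem_span_singleton.1 (hxy ▸ hx))

theorem isPFFrame_of_inf
    (h : ∀ I J : Ideal (RealFun L), IsZIdeal (I ⊓ J) → IsZIdeal I ∨ IsZIdeal J) :
    IsPFFrame L := by
  rintro _ _ ⟨f, rfl⟩ ⟨g, rfl⟩ hfg
  have hz : IsZIdeal (Ideal.span {f} ⊓ Ideal.span {g}) := by
    convert isZIdeal_bot
    rw [eq_bot_iff]
    rintro x ⟨hx, hx'⟩
    rw [Ideal.mem_bot, ← coz_eq_bot, ← le_bot_iff, ← hfg]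
    exact le_inf (span_singleton_le_cozIdeal f hx) (span_singleton_le_cozIdeal g hx')
  -- With `b = ⊥` the added ideal is zero, so `isComplemented_of_isZIdeal_sup` covers plain
  -- principal ideals.
  have hbot : ∀ f : RealFun L, Ideal.span {f} ⊔ cozIdeal ⊥ = Ideal.span {f} := fun f =>
    sup_eq_left.2 fun x hx => by
      rw [coz_eq_bot.1 (le_bot_iff.1 (mem_cozIdeal.1 hx))]
      exact zero_mem _
  refine (h _ _ hz).imp (fun h => ?_) fun h => ?_
  all_goals exact isComplemented_of_isZIdeal_sup (inf_bot_eq _) (by rwa [hbot])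

theorem isPFFrame_of_sup
    (h : ∀ I J : Ideal (RealFun L), I ⊔ J ≠ ⊤ → IsZIdeal (I ⊔ J) → IsZIdeal I ∨ IsZIdeal J) :
    IsPFFrame L := by
  rintro _ _ ⟨f, rfl⟩ ⟨g, rfl⟩ hfg
  have hsum : Ideal.span {f} ⊔ cozIdeal (coz g) ⊔ (Ideal.span {g} ⊔ cozIdeal (coz f)) =
      cozIdeal (coz f ⊔ coz g) := by
    rw [cozIdeal_sup, ← sup_eq_right.2 (span_singleton_le_cozIdeal f),
      ← sup_eq_right.2 (span_singleton_le_cozIdeal g)]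
    ac_rfl
  -- If the join is `⊤` the sum is not proper, but then `coz f` and `coz g` are complements of each
  -- other.
  by_cases htop : coz f ⊔ coz g = ⊤
  · exact Or.inl ⟨coz g, IsCompl.of_eq hfg htop⟩
  · refine (h _ _ ?_ (hsum ▸ isZIdeal_cozIdeal _)).imp
      (isComplemented_of_isZIdeal_sup hfg)
      (isComplemented_of_isZIdeal_sup (inf_comm (coz f) (coz g) ▸ hfg))
    rw [hsum, Ne, Ideal.eq_top_iff_one, mem_cozIdeal, coz_one, top_le_iff]
    exact htop

end CozIdeals

end PointFree

theorem mainTheorem3 {L : Type*} [Order.Frame L] (hL : PointFree.IsCompletelyRegular L) :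
    List.TFAE
      [∀ I J : Ideal (PointFree.RealFun L), I ⊔ J ≠ ⊤ → PointFree.IsZIdeal (I ⊔ J) →
        PointFree.IsZIdeal I ∨ PointFree.IsZIdeal J,
       PointFree.IsPFFrame L,
       ∀ I J : Ideal (PointFree.RealFun L), PointFree.IsZIdeal (I ⊓ J) →
        PointFree.IsZIdeal I ∨ PointFree.IsZIdeal J] := by
  tfae_have 1 → 2 := PointFree.isPFFrame_of_sup
  tfae_have 2 → 1 := fun h _ _ _ hz => h.isZIdeal_of_sup hz
  tfae_have 2 → 3 := fun h _ _ hz => h.isZIdeal_of_inf hz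
  tfae_have 3 → 2 := PointFree.isPFFrame_of_inf
  tfae_finish
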